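/- Let $F$ be a field of characteristic $2$ and let $\varphi,\psi$ be nondefective quadratic forms on finite-dimensional $F$-vector spaces (a form $q$ on $V$ with polar form $b_q(x,y)=q(x+y)+q(x)+q(y)$ is nondefective if its quasilinear index $i_{\mathrm{ql}}(q)=\dim\{x\in V : q(x)=0,\ b_q(x,y)=0 \text{ for all } y\in V\}$ is $0$). Suppose $n:=\dim\psi\ge 2$, and let $X=(X_1,\dots,X_n)$ be variables. For a field extension $E/F$ let $\varphi_E$ be the extension of $\varphi$ to $E\otimes_F V$, let $D_E^*(\varphi)\subseteq E^*$ be the set of nonzero values of $\varphi_E$, let $D_E^*(\varphi)^2=\{xy : x,y\in D_E^*(\varphi)\}$, and let $\langle S\rangle$ be the subgroup of $E^*$ generated by $S\subseteq E^*$. Let $\psi(X)\in F[X]$ be the polynomial of $\psi$ in a chosen basis. Let $F(\psi)$ be the quotient field of $F[X]/(\psi(X))$ if $\psi(X)$ is irreducible, and $F(\psi)=F$ otherwise (under the assumptions on $\psi$, the latter happens exactly when $\psi$ is a hyperbolic plane). A form is isotropic if it has a nontrivial zero, and quasilinear if it has positive dimension and its polar form is zero. Let $\mathcal E$ be the class of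 all field extensions $E/F$ with $i_{\mathrm{ql}}(\varphi_E)=0$ if $\psi$ is quasilinear, and the class of all field extensions $E/F$ otherwise. Then the following assertions are equivalent: 1. $\varphi_{F(\psi)}$ is isotropic; 2. $D_E^*(\psi)^2\subseteq D_E^*(\varphi)^2$ for every $E\in\mathcal E$; 3. $a\,\psi(X)\in D_{F(X)}^*(\varphi)^2$ for every $a\in D_F^*(\psi)$; 4. $\langle D_E^*(\psi)^2\rangle\subseteq\langle D_E^*(\varphi)^2\rangle$ for every $E\in\mathcal E$; 5. $a\,\psi(X)\in\langle D_{F(X)}^*(\varphi)^2\rangle$ for every $a\in D_F^*(\psi)$; 6. $\langle D_E^*(a\psi)\rangle\subseteq\langle D_E^*(\varphi)\rangle$ for every $E\in\mathcal E$ and every $a\in D_F^*(\psi)$; 7. $a\,\psi(X)\in\langle D_{F(X)}^*(\varphi)\rangle$ for every $a\in D_F^*(\psi)$. -/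

import Mathlib

open scoped TensorProduct Pointwise

universe u v w v₁ v₂

noncomputable section

namespace CharTwoQF

section Basic

variable {K : Type u} [Field K] {V : Type v} [AddCommGroup V] [Module K V]

/-- A quadratic form is isotropic if it has a nontrivial zero. -/
def IsIsotropic (Q : QuadraticForm K V) : Prop := ∃ x : V, x ≠ 0 ∧ Q x = 0

/-- The quasilinear index (defect) of `Q`. The radical of `Q` is the zero set of the quasilinear
part of `Q` (the restriction of `Q` to the radical of its polar form); for a form
`i × ℍ ⊥ Q_r ⊥ Q_s ⊥ j × ⟨0⟩` with `Q_r` nonsingular, `Q_s` quasilinear and `Q_r ⊥ Q_s` anisotropic,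
it is the subspace carrying `j × ⟨0⟩`, so its dimension is `j`. -/
def quasilinearIndex (Q : QuadraticForm K V) : ℕ := Module.finrank K Q.radical

theorem mem_radical_iff_polar (Q : QuadraticForm K V) (x : V) :
    x ∈ Q.radical ↔ Q x = 0 ∧ ∀ y : V, QuadraticMap.polar Q x y = 0 := by
  rw [QuadraticMap.mem_radical_iff']
  refine and_congr_right fun h => forall_congr' fun y => ?_
  simp [QuadraticMap.polar, h, sub_eq_zero]

/-- A form is nondefective if its quasilinear index is zero. -/
def IsNondefective (Q : QuadraticForm K V) : Prop := quasilinearIndex Q = 0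

/-- A form is quasilinear (totally singular) if it is of type `(0, s)` with `s > 0`, that is, its
polar form vanishes and its dimension is positive. -/
def IsQuasilinear (Q : QuadraticForm K V) : Prop :=
  0 < Module.finrank K V ∧ ∀ x y : V, QuadraticMap.polar Q x y = 0

/-- The set `D_K^*(Q)` of nonzero elements of `K` represented by `Q`. Its pointwise power
`repUnits Q ^ 2` is the set `D_K^*(Q)^2` of products of two such elements. -/
def repUnits (Q : QuadraticForm K V) : Set Kˣ := {c | ∃ x : V, Q x = (c : K)}

/-- The multiplicative group `⟨D_K^*(Q)⟩` generated by the nonzero values of `Q`. -/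
def repGroup (Q : QuadraticForm K V) : Subgroup Kˣ := Subgroup.closure (repUnits Q)

/-- The multiplicative group `⟨D_K^*(Q)^2⟩` generated by the products of two nonzero values. -/
def repSqGroup (Q : QuadraticForm K V) : Subgroup Kˣ := Subgroup.closure (repUnits Q ^ 2)

end Basic

section Extension

variable {F : Type u} [Field F] {V : Type v} [AddCommGroup V] [Module F V]

/-- The form `φ_E` on `E ⊗[F] V`, for a field extension `E` of `F`. (`QuadraticForm.baseChange`
needs `2` to be invertible.) It is defined through a bilinear form `B` with `φ x = B x x`; the
result does not depend on the choice of `B`, see `extend_unique`. -/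
def extend (E : Type w) [Field E] [Algebra F E] (φ : QuadraticForm F V) :
    QuadraticForm E (E ⊗[F] V) :=
  (LinearMap.BilinForm.baseChange E
    (LinearMap.BilinMap.toQuadraticMap_surjective φ).choose).toQuadraticMap

theorem extend_tmul (E : Type w) [Field E] [Algebra F E] (φ : QuadraticForm F V) (a : E) (x : V) :
    extend E φ (a ⊗ₜ[F] x) = a ^ 2 * algebraMap F E (φ x) := by
  have h := DFunLike.congr_fun (LinearMap.BilinMap.toQuadraticMap_surjective φ).choose_spec x
  rw [LinearMap.BilinMap.toQuadraticMap_apply] at h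
  rw [extend, LinearMap.BilinMap.toQuadraticMap_apply, LinearMap.BilinForm.baseChange_tmul, h,
    Algebra.smul_def]
  ring

theorem polar_extend_tmul (E : Type w) [Field E] [Algebra F E] (φ : QuadraticForm F V)
    (a b : E) (x y : V) :
    QuadraticMap.polar (extend E φ) (a ⊗ₜ[F] x) (b ⊗ₜ[F] y) =
      a * b * algebraMap F E (QuadraticMap.polar φ x y) := by
  have h : QuadraticMap.polar φ x y =
      QuadraticMap.polar
        (LinearMap.BilinMap.toQuadraticMap_surjective φ).choose.toQuadraticMap x y := by
    rw [(LinearMap.BilinMap.toQuadraticMap_surjective φ).choose_spec]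
  rw [h, LinearMap.BilinMap.polar_toQuadraticMap, extend, LinearMap.BilinMap.polar_toQuadraticMap,
    LinearMap.BilinForm.baseChange_tmul, LinearMap.BilinForm.baseChange_tmul, Algebra.smul_def,
    Algebra.smul_def, map_add]
  ring

theorem extend_unique (E : Type w) [Field E] [Algebra F E] (φ : QuadraticForm F V)
    (Q : QuadraticForm E (E ⊗[F] V)) (h : ∀ x : V, Q (1 ⊗ₜ[F] x) = algebraMap F E (φ x)) :
    Q = extend E φ :=
  baseChange_ext fun x => by rw [h, extend_tmul, one_pow, one_mul]

end Extension

section FunctionField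

variable {F : Type u} [Field F] {n : ℕ}

/-- The polynomial `ψ(X₁, …, Xₙ)`, in the coordinates given by the basis `b`. -/
def formPoly {W : Type w} [AddCommGroup W] [Module F W] (ψ : QuadraticForm F W)
    (b : Module.Basis (Fin n) F W) : MvPolynomial (Fin n) F :=
  ∑ i, MvPolynomial.C (ψ (b i)) * MvPolynomial.X i ^ 2 +
    ∑ i, ∑ j ∈ Finset.Ioi i, MvPolynomial.C (QuadraticMap.polar ψ (b i) (b j)) *
      (MvPolynomial.X i * MvPolynomial.X j)

theorem eval_formPoly {W : Type w} [AddCommGroup W] [Module F W] (ψ : QuadraticForm F W)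
    (b : Module.Basis (Fin n) F W) (c : Fin n → F) :
    MvPolynomial.eval c (formPoly ψ b) = ψ (∑ i, c i • b i) := by
  rw [QuadraticMap.map_sum, Finset.sum_sym2_filter_not_isDiag]
  have h : (Finset.univ : Finset (Fin n)).offDiag.filter (fun p => p.1 < p.2) =
      (Finset.univ ×ˢ Finset.univ).filter (fun p => p.1 < p.2) := by
    ext p
    simpa using ne_of_lt
  rw [h, Finset.sum_filter, Finset.sum_product]
  simp only [formPoly, map_add, map_sum, map_mul, map_pow, MvPolynomial.eval_C,
    MvPolynomial.eval_X, QuadraticMap.map_smul, smul_eq_mul, Sym2.map_mk,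
    QuadraticMap.polarSym2_sym2Mk, QuadraticMap.polar_smul_left, QuadraticMap.polar_smul_right]
  congr 1
  · exact Finset.sum_congr rfl fun i _ => by ring
  · refine Finset.sum_congr rfl fun i _ => ?_
    rw [← Finset.sum_filter, Finset.filter_lt_eq_Ioi]
    exact Finset.sum_congr rfl fun j _ => by ring

/-- The field `F(X₁, …, Xₙ)` of rational functions. -/
abbrev RatField (F : Type u) [Field F] (n : ℕ) : Type u := FractionRing (MvPolynomial (Fin n) F)

/-- The element `a ψ(X₁, …, Xₙ)` of `F(X₁, …, Xₙ)`. -/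
def scaledGenericValue {W : Type w} [AddCommGroup W] [Module F W] (a : Fˣ)
    (ψ : QuadraticForm F W) (b : Module.Basis (Fin n) F W) : RatField F n :=
  algebraMap (MvPolynomial (Fin n) F) (RatField F n) (MvPolynomial.C (a : F) * formPoly ψ b)

/-- The function field `F(f)` of an irreducible polynomial `f`: the quotient field of the domain
`F[X₁, …, Xₙ] / (f)`. -/
abbrev PolyFunctionField (f : MvPolynomial (Fin n) F) : Type u :=
  FractionRing (MvPolynomial (Fin n) F ⧸ Ideal.span {f})

theorem isDomain_quotient {f : MvPolynomial (Fin n) F} (hf : Irreducible f) :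
    IsDomain (MvPolynomial (Fin n) F ⧸ Ideal.span {f}) :=
  (Ideal.Quotient.isDomain_iff_prime _).2
    ((Ideal.span_singleton_prime hf.ne_zero).2 hf.prime)

open Classical in
/-- `φ_{F(ψ)}` is isotropic. If the polynomial `ψ(X)` is irreducible, `F(ψ)` is the function field
of that polynomial. Otherwise (for a nondefective form `ψ ≠ 0` this happens exactly for
`ψ ≅ ⟨a⟩` and `ψ ≅ ℍ`) one has `F(ψ) = F` by convention. -/
def IsotropicOverFunctionField {V : Type v} [AddCommGroup V] [Module F V] {W : Type w}
    [AddCommGroup W] [Module F W] (φ : QuadraticForm F V) (ψ : QuadraticForm F W)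
    (b : Module.Basis (Fin n) F W) : Prop :=
  if h : Irreducible (formPoly ψ b) then
    haveI := isDomain_quotient h
    IsIsotropic (extend (PolyFunctionField (formPoly ψ b)) φ)
  else IsIsotropic φ

end FunctionField

/-- `E` belongs to the class of admissible extensions: all field extensions of `F`, except that
`φ_E` has to be nondefective when `ψ` is quasilinear. -/
def IsAdmissible {F : Type u} [Field F] {V : Type*} [AddCommGroup V] [Module F V] {W : Type*}
    [AddCommGroup W] [Module F W] (φ : QuadraticForm F V) (ψ : QuadraticForm F W)
    (E : Type w) [Field E] [Algebra F E] : Prop :=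
  IsQuasilinear ψ → IsNondefective (extend E φ)

end CharTwoQF

end

open CharTwoQF

/-!
Over every extension and over `F[X]`, `F[X, Y][t]`, …, forms are handled in coordinates:
`coordForm M R` is the form on `R ^ ι` with coefficient matrix `M`, for any `F`-algebra `R`, and
it is natural in `R`.

*From isotropy to values.* If `φ` is isotropic over `F` then, being nondefective, it is universal
over every extension. Otherwise `φ` has an isotropic vector modulo the prime `ψ(X)`. On the
generic line `X + t Y` it becomes an isotropic vector modulo the quadratic polynomial `ψ(X + t Y)`
in `t`, which does not vanish there because the shear `X ↦ X - t Y` moves the line back to the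
generic point (`lineHom_not_dvd`). Its remainder `x + t y` satisfies `φ(x + t y) = c ψ(X + t Y)`
with `c` free of `t`, and `c ≠ 0` since `φ` stays anisotropic over rational function fields.
Comparing coefficients, `φ(x) = c ψ(X)` and `φ(y) = c ψ(Y)` (`exists_generic_common_slot`). So
`ψ(X) ψ(Y)` is generically a product of two values of `φ`. To reach given points over an extension
`E`, restrict to a curve in one parameter through these points along which `c` does not vanish
identically (`exists_curve`), and let the parameter tend to `0` (`exists_mul_eq_eval_mul_eval`).
If `c` vanishes there, either the form turns out to be universal over `E`, or `x` and `y` can be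
divided by the parameter after subtracting a constant vector of the radical. This argument applies
to all extensions `E`, also when `φ_E` is defective.

*From values to isotropy.* If `φ` is anisotropic modulo a prime `π`, then the nonzero values of
`φ`, and hence the group that they generate, have even valuation at `π` (`repGroup_le_evenUnits`).
When `ψ(X)` is irreducible, `a ψ(X)` has valuation one at `π = ψ(X)`. When it is reducible, it has
a linear factor `π` of multiplicity one (`exists_prime_linear_factor`), and `F[X] / (π)` embeds in
`F[X]`, over which `φ` stays anisotropic if it is so over `F`.

The other implications are formal. Those that specialize to `F(X)` use that `φ` stays nondefective
there.
-/

namespace CharTwoQF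

/-! ### Quadratic forms in coordinates -/

section CoordForm

variable {F : Type*} [Field F] {ι : Type*} [Fintype ι] [DecidableEq ι]

/-- The quadratic form `x ↦ ∑ i, ∑ j, M i j * x i * x j` on `R ^ ι`, for an `F`-algebra `R` and a
(not necessarily symmetric) matrix `M` over `F`. -/
noncomputable def coordForm (M : Matrix ι ι F) (R : Type*) [CommRing R] [Algebra F R] :
    QuadraticForm R (ι → R) :=
  (Matrix.toBilin' (M.map (algebraMap F R))).toQuadraticMap

variable (M : Matrix ι ι F)

theorem coordForm_apply {R : Type*} [CommRing R] [Algebra F R] (x : ι → R) :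
    coordForm M R x = ∑ i, ∑ j, x i * algebraMap F R (M i j) * x j := by
  rw [coordForm, LinearMap.BilinMap.toQuadraticMap_apply, Matrix.toBilin'_apply]
  simp

theorem coordForm_comp {R S : Type*} [CommRing R] [Algebra F R] [CommRing S] [Algebra F S]
    (h : R →ₐ[F] S) (x : ι → R) : coordForm M S (fun i => h (x i)) = h (coordForm M R x) := by
  simp [coordForm_apply]

theorem polar_coordForm_comp {R S : Type*} [CommRing R] [Algebra F R] [CommRing S] [Algebra F S]
    (h : R →ₐ[F] S) (x y : ι → R) :
    QuadraticMap.polar (coordForm M S) (fun i => h (x i)) (fun i => h (y i)) =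
      h (QuadraticMap.polar (coordForm M R) x y) := by
  simp only [QuadraticMap.polar, map_sub, ← coordForm_comp]
  simp only [Pi.add_def, map_add]

/-- The polar form vanishes identically on a vector as soon as it does so on the basis vectors. -/
theorem polar_eq_zero_of_single {R : Type*} [CommRing R] (Q : QuadraticForm R (ι → R)) (x : ι → R)
    (h : ∀ j, QuadraticMap.polar Q x (Pi.single j 1) = 0) (y : ι → R) :
    QuadraticMap.polar Q x y = 0 := by
  have : Q.polarBilin x = 0 := by
    refine (Pi.basisFun R ι).ext fun j => ?_
    simpa using h j
  simpa using LinearMap.congr_fun this y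

/-- The radical survives scalar extension: a vector in the radical of `coordForm M R` maps into the
radical of `coordForm M S`. -/
theorem comp_mem_radical {R S : Type*} [Field R] [Algebra F R] [CommRing S] [Algebra F S]
    (h : R →ₐ[F] S) {x : ι → R} (hx : x ∈ (coordForm M R).radical) (y : ι → S) :
    coordForm M S (fun i => h (x i)) = 0 ∧
      QuadraticMap.polar (coordForm M S) (fun i => h (x i)) y = 0 := by
  rw [mem_radical_iff_polar] at hx
  refine ⟨by rw [coordForm_comp, hx.1, map_zero], polar_eq_zero_of_single _ _ (fun j => ?_) y⟩
  have := polar_coordForm_comp M h x (Pi.single j 1)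
  rw [hx.2, map_zero] at this
  rw [← this]
  congr 1
  ext i
  by_cases hij : i = j
  · subst hij; simp
  · simp [hij]

end CoordForm

section Gram

variable {F : Type u} [Field F] {V : Type v} [AddCommGroup V] [Module F V]
variable {ι : Type*} [Fintype ι] [DecidableEq ι]

/-- A matrix of `φ` in the basis `e`: the matrix of the bilinear form `B` with `φ x = B x x` on
which the definition of `extend` rests. -/
noncomputable def gram (φ : QuadraticForm F V) (e : Module.Basis ι F V) : Matrix ι ι F :=
  fun i j => (LinearMap.BilinMap.toQuadraticMap_surjective φ).choose (e i) (e j)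

/-- In coordinates, `φ_E` is the form with the matrix of `φ`. -/
noncomputable def extendIsometry (E : Type w) [Field E] [Algebra F E] (φ : QuadraticForm F V)
    (e : Module.Basis ι F V) :
    QuadraticMap.IsometryEquiv (coordForm (gram φ e) E) (extend E φ) where
  toLinearEquiv := (Module.Basis.baseChange E e).equivFun.symm
  map_app' x := by
    change extend E φ ((Module.Basis.baseChange E e).equivFun.symm x) = _
    rw [Module.Basis.equivFun_symm_apply, coordForm_apply, extend,
      LinearMap.BilinMap.toQuadraticMap_apply]
    simp only [map_sum, LinearMap.sum_apply, map_smul, LinearMap.smul_apply,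
      Module.Basis.baseChange_apply, LinearMap.BilinForm.baseChange_tmul, gram, smul_eq_mul,
      Algebra.smul_def]
    rw [Finset.sum_comm]
    refine Finset.sum_congr rfl fun i _ => ?_
    rw [Finset.mul_sum]
    refine Finset.sum_congr rfl fun j _ => ?_
    ring

/-- In coordinates, `φ` is the form with the matrix of `φ`. -/
noncomputable def coordIsometry (φ : QuadraticForm F V) (e : Module.Basis ι F V) :
    QuadraticMap.IsometryEquiv (coordForm (gram φ e) F) φ where
  toLinearEquiv := e.equivFun.symm
  map_app' x := by
    change φ (e.equivFun.symm x) = _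
    have h := DFunLike.congr_fun (LinearMap.BilinMap.toQuadraticMap_surjective φ).choose_spec
      (e.equivFun.symm x)
    rw [← h, Module.Basis.equivFun_symm_apply, coordForm_apply,
      LinearMap.BilinMap.toQuadraticMap_apply]
    simp only [map_sum, LinearMap.sum_apply, map_smul, LinearMap.smul_apply, gram, smul_eq_mul,
      Algebra.algebraMap_self, RingHom.id_apply]
    rw [Finset.sum_comm]
    refine Finset.sum_congr rfl fun i _ => ?_
    rw [Finset.mul_sum]
    refine Finset.sum_congr rfl fun j _ => ?_
    ring

section Isometry

variable {K : Type*} [Field K] {V₁ V₂ : Type*} [AddCommGroup V₁] [Module K V₁] [AddCommGroup V₂]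
  [Module K V₂] {Q₁ : QuadraticForm K V₁} {Q₂ : QuadraticForm K V₂}

theorem isIsotropic_congr (f : QuadraticMap.IsometryEquiv Q₁ Q₂) :
    IsIsotropic Q₁ ↔ IsIsotropic Q₂ := by
  constructor
  · rintro ⟨x, hx, h⟩
    exact ⟨f x, fun h0 => hx (f.toLinearEquiv.map_eq_zero_iff.1 h0), by rw [f.map_app, h]⟩
  · rintro ⟨x, hx, h⟩
    refine ⟨f.symm x, fun h0 => hx (f.symm.toLinearEquiv.map_eq_zero_iff.1 h0), ?_⟩
    rw [f.symm.map_app, h]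

theorem isNondefective_congr (f : QuadraticMap.IsometryEquiv Q₁ Q₂) :
    IsNondefective Q₁ ↔ IsNondefective Q₂ := by
  rw [IsNondefective, IsNondefective, quasilinearIndex, quasilinearIndex,
    QuadraticMap.Equivalent.rank_radical_eq ⟨f⟩]

theorem repUnits_congr (f : QuadraticMap.IsometryEquiv Q₁ Q₂) : repUnits Q₁ = repUnits Q₂ := by
  ext c
  constructor
  · rintro ⟨x, hx⟩
    exact ⟨f x, by rw [f.map_app, hx]⟩
  · rintro ⟨x, hx⟩
    exact ⟨f.symm x, by rw [f.symm.map_app, hx]⟩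

theorem isNondefective_iff_radical [FiniteDimensional K V₁] :
    IsNondefective Q₁ ↔ Q₁.radical = ⊥ :=
  Submodule.finrank_eq_zero

end Isometry

/-- The polynomial of a quadratic form is the value of the form at the vector of variables. -/
theorem formPoly_eq_coordForm {n : ℕ} (φ : QuadraticForm F V) (b : Module.Basis (Fin n) F V) :
    formPoly φ b = coordForm (gram φ b) (MvPolynomial (Fin n) F) MvPolynomial.X := by
  have hs : (MvPolynomial.X : Fin n → MvPolynomial (Fin n) F) =
      ∑ i, (MvPolynomial.X i : MvPolynomial (Fin n) F) • Pi.single i 1 := by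
    ext1 i
    simp [Finset.sum_apply, Pi.single_apply]
  have h1 : ∀ i, coordForm (gram φ b) (MvPolynomial (Fin n) F) (Pi.single i 1) =
      MvPolynomial.C (φ (b i)) := fun i => by
    have := DFunLike.congr_fun (LinearMap.BilinMap.toQuadraticMap_surjective φ).choose_spec (b i)
    rw [← this, coordForm_apply]
    simp [Pi.single_apply, gram, MvPolynomial.algebraMap_eq]
  have h2 : ∀ i j, QuadraticMap.polar (coordForm (gram φ b) (MvPolynomial (Fin n) F))
      (Pi.single i 1) (Pi.single j 1) = MvPolynomial.C (QuadraticMap.polar φ (b i) (b j)) :=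
    fun i j => by
      have : QuadraticMap.polar φ (b i) (b j) = QuadraticMap.polar
          (LinearMap.BilinMap.toQuadraticMap_surjective φ).choose.toQuadraticMap (b i) (b j) := by
        rw [(LinearMap.BilinMap.toQuadraticMap_surjective φ).choose_spec]
      rw [this, coordForm, LinearMap.BilinMap.polar_toQuadraticMap,
        LinearMap.BilinMap.polar_toQuadraticMap]
      simp [gram, MvPolynomial.algebraMap_eq]
  rw [hs, QuadraticMap.map_sum, Finset.sum_sym2_filter_not_isDiag]
  have h : (Finset.univ : Finset (Fin n)).offDiag.filter (fun p => p.1 < p.2) =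
      (Finset.univ ×ˢ Finset.univ).filter (fun p => p.1 < p.2) := by
    ext p
    simpa using ne_of_lt
  rw [h, Finset.sum_filter, Finset.sum_product]
  simp only [formPoly, QuadraticMap.map_smul, smul_eq_mul, Sym2.map_mk,
    QuadraticMap.polarSym2_sym2Mk, QuadraticMap.polar_smul_left, QuadraticMap.polar_smul_right,
    h1, h2]
  congr 1
  · exact Finset.sum_congr rfl fun i _ => by ring
  · refine Finset.sum_congr rfl fun i _ => ?_
    rw [← Finset.sum_filter, Finset.filter_lt_eq_Ioi]
    exact Finset.sum_congr rfl fun j _ => by ring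

end Gram

/-! ### Clearing denominators and extracting prime powers -/

section Vectors

variable {ι : Type*}

theorem exists_common_denominator [Finite ι] {D K : Type*} [CommRing D] [IsDomain D] [Field K]
    [Algebra D K] [IsFractionRing D K] (f : ι → K) :
    ∃ (d : D) (g : ι → D), d ≠ 0 ∧ ∀ i, algebraMap D K (g i) = algebraMap D K d * f i := by
  obtain ⟨d, hd⟩ := IsLocalization.exist_integer_multiples_of_finite (nonZeroDivisors D) f
  choose g hg using hd
  refine ⟨d, g, nonZeroDivisors.coe_ne_zero d, fun i => ?_⟩
  rw [hg i, Algebra.smul_def]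

theorem exists_eq_pow_mul_not_dvd {R : Type*} [CommRing R] [IsDomain R] [WfDvdMonoid R] {π : R}
    (hπ : Prime π) {f : ι → R} (hf : f ≠ 0) :
    ∃ (k : ℕ) (g : ι → R), (∀ i, f i = π ^ k * g i) ∧ ∃ i, ¬π ∣ g i := by
  classical
  obtain ⟨i₀, hi₀⟩ := Function.ne_iff.1 hf
  obtain ⟨m, hm⟩ := FiniteMultiplicity.of_not_isUnit hπ.not_isUnit hi₀
  have hex : ∃ k, ¬∀ i, π ^ k ∣ f i := ⟨m + 1, fun h => hm (h i₀)⟩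
  obtain ⟨k, hk⟩ : ∃ k, Nat.find hex = k + 1 := Nat.exists_eq_succ_of_ne_zero fun h0 => by
    have := Nat.find_spec hex
    rw [h0] at this
    simp at this
  have h1 : ∀ i, π ^ k ∣ f i := not_not.1 (Nat.find_min hex (hk ▸ Nat.lt_succ_self k))
  have h2 := Nat.find_spec hex
  rw [hk] at h2
  choose g hg using h1
  refine ⟨k, g, hg, ?_⟩
  by_contra! hall
  refine h2 fun i => ?_
  rw [hg i, pow_succ]
  exact mul_dvd_mul_left _ (hall i)

end Vectors

/-! ### Transfer along polynomial rings and their fraction fields -/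

section Transfer

open Polynomial

/-- A nonzero polynomial does not vanish on a suitable polynomial curve through a given point. The
field may be finite, so a line would not do. -/
theorem exists_curve {E : Type*} [Field E] {σ : Type*} {p : MvPolynomial σ E} (hp : p ≠ 0)
    (v : σ → E) : ∃ γ : σ → E[X], (∀ i, (γ i).eval 0 = v i) ∧ MvPolynomial.aeval γ p ≠ 0 := by
  by_contra! hall
  have hinf : ∀ i, (Set.range fun g : E[X] => C (v i) + X * g).Infinite := fun i =>
    Set.infinite_range_of_injective fun g₁ g₂ h => mul_left_cancel₀ X_ne_zero (add_left_cancel h)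
  have h0 : MvPolynomial.map (C : E →+* E[X]) p = 0 := by
    refine MvPolynomial.funext_set _ hinf fun γ hγ => ?_
    rw [MvPolynomial.eval_map, map_zero]
    refine hall γ fun i => ?_
    obtain ⟨g, hg⟩ := hγ i trivial
    simp [← hg]
  exact hp (MvPolynomial.map_injective _ C_injective (by rw [h0, map_zero]))

variable {F : Type*} [Field F] {ι : Type*}

/-- A nonzero polynomial vector, restricted to a suitable curve and divided by a power of the
parameter, has a nonzero value at the origin. -/
theorem exists_specialization {σ : Type*} {f : ι → MvPolynomial σ F} (hf : f ≠ 0) :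
    ∃ (h : MvPolynomial σ F →ₐ[F] F[X]) (k : ℕ) (g : ι → F[X]),
      (∀ i, h (f i) = X ^ k * g i) ∧ (fun i => (g i).eval 0) ≠ 0 := by
  obtain ⟨i₀, hi₀⟩ := Function.ne_iff.1 hf
  obtain ⟨γ, -, hγ⟩ := exists_curve hi₀ 0
  have hne : (fun i => MvPolynomial.aeval γ (f i)) ≠ 0 := fun h => hγ (congrFun h i₀)
  obtain ⟨k, g, hg, i, hi⟩ := exists_eq_pow_mul_not_dvd prime_X hne
  refine ⟨MvPolynomial.aeval γ, k, g, hg, fun h => hi ?_⟩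
  rw [X_dvd_iff, coeff_zero_eq_eval_zero]
  exact congrFun h i

variable [Fintype ι] [DecidableEq ι] (M : Matrix ι ι F)

theorem coordForm_eval (x : ι → F[X]) :
    coordForm M F (fun i => (x i).eval 0) = (coordForm M F[X] x).eval 0 := by
  simpa using coordForm_comp M (aeval (0 : F) : F[X] →ₐ[F] F) x

theorem polar_coordForm_eval (x y : ι → F[X]) :
    QuadraticMap.polar (coordForm M F) (fun i => (x i).eval 0) (fun i => (y i).eval 0) =
      (QuadraticMap.polar (coordForm M F[X]) x y).eval 0 := by
  simpa using polar_coordForm_comp M (aeval (0 : F) : F[X] →ₐ[F] F) x y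

theorem anisotropic_mvPolynomial {σ : Type*} (hM : ∀ x, coordForm M F x = 0 → x = 0)
    (f : ι → MvPolynomial σ F) (hf : coordForm M (MvPolynomial σ F) f = 0) : f = 0 := by
  by_contra hne
  obtain ⟨h, k, g, hg, hg0⟩ := exists_specialization hne
  refine hg0 (hM _ ?_)
  have h1 := coordForm_comp M h f
  have h2 : (fun i => h (f i)) = (X ^ k : F[X]) • g := funext hg
  rw [hf, map_zero, h2, QuadraticMap.map_smul, smul_eq_mul, mul_eq_zero] at h1
  rw [coordForm_eval, h1.resolve_left (by simp [X_ne_zero]), eval_zero]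

theorem anisotropic_fractionField {D K : Type*} [CommRing D] [IsDomain D] [Field K] [Algebra D K]
    [IsFractionRing D K] [Algebra F D] [Algebra F K] [IsScalarTower F D K]
    (hM : ∀ f, coordForm M D f = 0 → f = 0) (x : ι → K) (hx : coordForm M K x = 0) : x = 0 := by
  obtain ⟨d, g, hd, hg⟩ := exists_common_denominator (D := D) x
  have hd' : algebraMap D K d ≠ 0 := by simpa using hd
  have h1 := coordForm_comp M (IsScalarTower.toAlgHom F D K) g
  have h2 : (fun i => IsScalarTower.toAlgHom F D K (g i)) = algebraMap D K d • x := funext hg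
  rw [h2, QuadraticMap.map_smul, hx, smul_zero, eq_comm, IsScalarTower.coe_toAlgHom',
    FaithfulSMul.algebraMap_eq_zero_iff] at h1
  funext i
  have h3 := hg i
  rw [hM g h1, Pi.zero_apply, map_zero, eq_comm, mul_eq_zero] at h3
  exact h3.resolve_left hd'

theorem radical_rationalFunctionField {σ : Type*} (hM : (coordForm M F).radical = ⊥) :
    (coordForm M (FractionRing (MvPolynomial σ F))).radical = ⊥ := by
  rw [eq_bot_iff]
  intro x hx
  rw [mem_radical_iff_polar] at hx
  by_contra hne
  obtain ⟨d, f, hd, hf⟩ := exists_common_denominator (D := MvPolynomial σ F) x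
  have hinj := IsFractionRing.injective (MvPolynomial σ F) (FractionRing (MvPolynomial σ F))
  have hd' : algebraMap _ (FractionRing (MvPolynomial σ F)) d ≠ 0 := by simpa using hd
  set j := IsScalarTower.toAlgHom F (MvPolynomial σ F) (FractionRing (MvPolynomial σ F)) with hj
  have h2 : (fun i => j (f i)) =
    algebraMap _ (FractionRing (MvPolynomial σ F)) d • x := funext hf
  have hq : coordForm M (MvPolynomial σ F) f = 0 := by
    apply hinj
    have := coordForm_comp M j f
    rw [h2, QuadraticMap.map_smul, hx.1, smul_zero] at this
    rw [map_zero, this]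
    rfl
  have hp : ∀ y, QuadraticMap.polar (coordForm M (MvPolynomial σ F)) f y = 0 := fun y => by
    apply hinj
    have := polar_coordForm_comp M j f y
    rw [h2, QuadraticMap.polar_smul_left, hx.2, smul_zero] at this
    rw [map_zero, this]
    rfl
  have hf0 : f ≠ 0 := by
    rintro rfl
    refine hne (funext fun i => ?_)
    have h3 := hf i
    rw [Pi.zero_apply, map_zero, eq_comm, mul_eq_zero] at h3
    exact h3.resolve_left hd'
  obtain ⟨h, k, g, hg, hg0⟩ := exists_specialization hf0
  have h4 : (fun i => h (f i)) = (X ^ k : F[X]) • g := funext hg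
  have hX : (X ^ k : F[X]) ≠ 0 := by simp [X_ne_zero]
  refine hg0 ((Submodule.mem_bot F).1 (hM ▸ ?_))
  rw [mem_radical_iff_polar]
  constructor
  · have h1 := coordForm_comp M h f
    rw [hq, map_zero, h4, QuadraticMap.map_smul, smul_eq_mul, mul_eq_zero] at h1
    rw [coordForm_eval, h1.resolve_left (by simp [X_ne_zero]), eval_zero]
  · refine polar_eq_zero_of_single _ _ fun i => ?_
    have h1 := polar_coordForm_comp M h f (Pi.single i 1)
    have h5 : (fun l => h ((Pi.single i 1 : ι → MvPolynomial σ F) l)) = Pi.single i 1 := by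
      ext1 l
      by_cases hil : l = i
      · subst hil; simp
      · simp [hil]
    have h6 : (Pi.single i 1 : ι → F) = fun l => ((Pi.single i 1 : ι → F[X]) l).eval 0 := by
      ext1 l
      by_cases hil : l = i
      · subst hil; simp
      · simp [hil]
    rw [hp, map_zero, h4, h5, QuadraticMap.polar_smul_left, smul_eq_mul, mul_eq_zero] at h1
    rw [h6, polar_coordForm_eval, h1.resolve_left hX, eval_zero]

end Transfer

/-! ### Universal forms and specialization of products of two values -/

section Specialization

open Polynomial

theorem exists_eq_of_isotropic_not_mem_radical {K : Type*} [Field K] {V : Type*} [AddCommGroup V]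
    [Module K V] {Q : QuadraticForm K V} {x : V} (hx : Q x = 0) (hr : x ∉ Q.radical) (c : K) :
    ∃ z, Q z = c := by
  rw [mem_radical_iff_polar] at hr
  push Not at hr
  obtain ⟨y, hy⟩ := hr hx
  refine ⟨((c - Q y) / QuadraticMap.polar Q x y) • x + y, ?_⟩
  rw [QuadraticMap.map_add Q, QuadraticMap.map_smul, hx, QuadraticMap.polar_smul_left, smul_zero,
    smul_eq_mul, div_mul_cancel₀ _ hy]
  ring

variable {E : Type*} [Field E] {ι : Type*} [Fintype ι] [DecidableEq ι] (M : Matrix ι ι E)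

/-- If `c a` and `c b` are values of a form over `E[X]`, where `c ≠ 0` and `a`, `b` do not vanish at
the origin, then `a(0) b(0)` is a product of two values over `E`. The factor `c` may vanish at
the origin; either the two vectors can then be divided by `X`, up to a constant vector in the
radical, or the form is universal over `E`. -/
theorem exists_mul_eq_eval_mul_eval {a b : E[X]} (ha : a.eval 0 ≠ 0) (hb : b.eval 0 ≠ 0) :
    ∀ (c : E[X]) (x y : ι → E[X]), c ≠ 0 →
      coordForm M E[X] x = c * a → coordForm M E[X] y = c * b →
      ∃ z z', coordForm M E z * coordForm M E z' = a.eval 0 * b.eval 0 := by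
  intro c
  induction hN : c.natDegree using Nat.strong_induction_on generalizing c with
  | _ N ih =>
  intro x y hc hx hy
  have hx0 := coordForm_eval M x
  have hy0 := coordForm_eval M y
  rw [hx, eval_mul] at hx0
  rw [hy, eval_mul] at hy0
  by_cases hc0 : c.eval 0 = 0
  · rw [hc0, zero_mul] at hx0 hy0
    by_cases hxr : (fun i => (x i).eval 0) ∈ (coordForm M E).radical
    · by_cases hyr : (fun i => (y i).eval 0) ∈ (coordForm M E).radical
      · -- subtracting the constant terms does not change the values
        have key : ∀ w : ι → E[X], (fun i => (w i).eval 0) ∈ (coordForm M E).radical →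
            coordForm M E[X] w = X ^ 2 * coordForm M E[X] (fun i => (w i).divX) := fun w hw => by
          obtain ⟨h1, h2⟩ := comp_mem_radical M (CAlgHom (R := E) (A := E)) hw
            ((X : E[X]) • fun i => (w i).divX)
          have h3 : w = (fun i => CAlgHom (R := E) (A := E) ((w i).eval 0)) +
              (X : E[X]) • fun i => (w i).divX := by
            ext1 i
            simpa [add_comm, coeff_zero_eq_eval_zero] using (X_mul_divX_add (w i)).symm
          conv_lhs => rw [h3, QuadraticMap.map_add (coordForm M E[X]), h1, h2,
            QuadraticMap.map_smul]
          simp [sq]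
        rw [key x hxr] at hx
        rw [key y hyr] at hy
        have hXa : ¬(X : E[X]) ∣ a := by rwa [X_dvd_iff, coeff_zero_eq_eval_zero]
        obtain ⟨c', rfl⟩ : X ^ 2 ∣ c := prime_X.pow_dvd_of_dvd_mul_right 2 hXa ⟨_, hx.symm⟩
        have hX : (X ^ 2 : E[X]) ≠ 0 := pow_ne_zero _ X_ne_zero
        have hc' : c' ≠ 0 := right_ne_zero_of_mul hc
        refine ih c'.natDegree ?_ c' rfl _ _ hc' (mul_left_cancel₀ hX (hx.trans (mul_assoc _ _ _)))
          (mul_left_cancel₀ hX (hy.trans (mul_assoc _ _ _)))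
        rw [← hN, natDegree_mul hX hc', natDegree_X_pow]
        omega
      · obtain ⟨z, hz⟩ := exists_eq_of_isotropic_not_mem_radical hy0 hyr (a.eval 0)
        obtain ⟨z', hz'⟩ := exists_eq_of_isotropic_not_mem_radical hy0 hyr (b.eval 0)
        exact ⟨z, z', by rw [hz, hz']⟩
    · obtain ⟨z, hz⟩ := exists_eq_of_isotropic_not_mem_radical hx0 hxr (a.eval 0)
      obtain ⟨z', hz'⟩ := exists_eq_of_isotropic_not_mem_radical hx0 hxr (b.eval 0)
      exact ⟨z, z', by rw [hz, hz']⟩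
  · refine ⟨(c.eval 0)⁻¹ • fun i => (x i).eval 0, fun i => (y i).eval 0, ?_⟩
    rw [QuadraticMap.map_smul, hx0, hy0, smul_eq_mul]
    field_simp

end Specialization

/-! ### The form over a generic line -/

section GenericLine

open Polynomial

/-- The value at `x + t y`, as a polynomial in `t` (which is the variable `X` of `R[X]`). -/
theorem coordForm_line {F : Type*} [Field F] {ι : Type*} [Fintype ι] [DecidableEq ι]
    (M : Matrix ι ι F) {R : Type*} [CommRing R] [Algebra F R] (x y : ι → R) :
    coordForm M R[X] (fun i => C (x i) + X * C (y i)) =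
      C (coordForm M R x) + X * C (QuadraticMap.polar (coordForm M R) x y) +
        X ^ 2 * C (coordForm M R y) := by
  have h : (fun i => C (x i) + X * C (y i)) =
      (fun i => CAlgHom (R := F) (x i)) + (X : R[X]) • fun i => CAlgHom (R := F) (y i) := by
    ext1 i
    simp
  rw [h, QuadraticMap.map_add (coordForm M R[X]), QuadraticMap.map_smul,
    QuadraticMap.polar_smul_right, polar_coordForm_comp, coordForm_comp, coordForm_comp]
  simp only [CAlgHom_apply, smul_eq_mul]
  ring

variable {F : Type*} [Field F] {κ : Type*}

/-- The substitution `Z ↦ X + t Y` from `F[Z]` to `F[X, Y][t]`. The variables `Y` are indexed by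
the left summand and the variables `X` by the right one. -/
noncomputable def lineHom (F κ : Type*) [Field F] :
    MvPolynomial κ F →ₐ[F] (MvPolynomial (κ ⊕ κ) F)[X] :=
  MvPolynomial.aeval fun j =>
    C (MvPolynomial.X (Sum.inr j)) + X * C (MvPolynomial.X (Sum.inl j))

/-- The endomorphism of `F[X, Y][t]` which sends `X` to `X + ε t Y` and fixes `Y` and `t`. -/
noncomputable def shearHom (κ : Type*) (ε : F) :
    (MvPolynomial (κ ⊕ κ) F)[X] →+* (MvPolynomial (κ ⊕ κ) F)[X] :=
  eval₂RingHom (MvPolynomial.aeval (R := F) (Sum.elim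
    (fun j => (C (MvPolynomial.X (Sum.inl j)) : (MvPolynomial (κ ⊕ κ) F)[X]))
    (fun j => C (MvPolynomial.X (Sum.inr j)) +
      C (MvPolynomial.C ε) * (X * C (MvPolynomial.X (Sum.inl j)))))).toRingHom X

theorem shearHom_C (ε : F) (a : MvPolynomial (κ ⊕ κ) F) : shearHom κ ε (C a) =
    MvPolynomial.aeval (R := F) (Sum.elim
    (fun j => (C (MvPolynomial.X (Sum.inl j)) : (MvPolynomial (κ ⊕ κ) F)[X]))
    (fun j => C (MvPolynomial.X (Sum.inr j)) +
      C (MvPolynomial.C ε) * (X * C (MvPolynomial.X (Sum.inl j))))) a := by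
  simp [shearHom]

theorem shearHom_X (ε : F) : shearHom κ ε X = X := by
  simp [shearHom]

theorem shearHom_one_rename (a : MvPolynomial κ F) :
    shearHom κ 1 (C (MvPolynomial.rename Sum.inr a)) = lineHom F κ a := by
  rw [shearHom_C, MvPolynomial.aeval_rename, lineHom]
  refine congrArg (fun γ => MvPolynomial.aeval (R := F) γ a) (funext fun j => ?_)
  simp

theorem shearHom_one_shearHom_neg_one (a : MvPolynomial (κ ⊕ κ) F) :
    shearHom κ 1 (shearHom κ (-1) (C a)) = C a := by
  induction a using MvPolynomial.induction_on with
  | C r => simp [shearHom_C, MvPolynomial.algebraMap_eq, Polynomial.algebraMap_apply]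
  | add p q hp hq => simp only [map_add, hp, hq]
  | mul_X p j hp =>
    rw [C_mul, map_mul, map_mul, hp]
    congr 1
    cases j with
    | inl j => simp [shearHom_C]
    | inr j =>
      rw [shearHom_C]
      simp only [MvPolynomial.aeval_X, Sum.elim_inr, map_add, map_mul, shearHom_X, shearHom_C,
        Sum.elim_inl, map_neg, map_one]
      ring

theorem shearHom_neg_one_lineHom (a : MvPolynomial κ F) :
    shearHom κ (-1) (lineHom F κ a) = C (MvPolynomial.rename Sum.inr a) := by
  induction a using MvPolynomial.induction_on with
  | C r => simp [lineHom, shearHom_C, MvPolynomial.algebraMap_eq, Polynomial.algebraMap_apply]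
  | add p q hp hq => simp only [map_add, hp, hq]
  | mul_X p j hp =>
    rw [map_mul, map_mul, hp, map_mul, C_mul]
    congr 1
    simp only [lineHom, MvPolynomial.aeval_X, Sum.elim_inr, map_add, map_mul, shearHom_X,
      shearHom_C, Sum.elim_inl, MvPolynomial.rename_X, map_neg, map_one]
    ring

theorem prime_rename_inr {a : MvPolynomial κ F} (ha : Prime a) :
    Prime (MvPolynomial.rename (Sum.inr : κ → κ ⊕ κ) a) := by
  rw [← MulEquiv.prime_iff (MvPolynomial.sumRingEquiv F κ κ).toMulEquiv]
  have h : MvPolynomial.sumRingEquiv F κ κ (MvPolynomial.rename Sum.inr a) = MvPolynomial.C a := by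
    clear ha
    induction a using MvPolynomial.induction_on with
    | C r => simp
    | add p q hp hq => simp only [map_add, hp, hq]
    | mul_X p j hp => simp only [map_mul, hp, MvPolynomial.rename_X,
        MvPolynomial.sumRingEquiv_X_inr]
  change Prime (MvPolynomial.sumRingEquiv F κ κ _)
  rw [h]
  exact (MvPolynomial.prime_C_iff κ).2 ha

/-- A prime polynomial which does not divide `b` still does not divide `b` on the generic line, not
even over the field `F(X, Y)`: the shear `X ↦ X - t Y` moves the line to the generic point. -/
theorem lineHom_not_dvd {a b : MvPolynomial κ F} (ha : Prime a) (hab : ¬a ∣ b)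
    (hdeg : (lineHom F κ a).natDegree ≠ 0) {d : MvPolynomial (κ ⊕ κ) F} (hd : d ≠ 0) :
    ¬lineHom F κ a ∣ C d * lineHom F κ b := by
  intro h
  have h1 := _root_.map_dvd (shearHom κ (-1)) h
  rw [map_mul, shearHom_neg_one_lineHom, shearHom_neg_one_lineHom] at h1
  rcases (Polynomial.prime_C_iff.2 (prime_rename_inr ha)).dvd_or_dvd h1 with h2 | h2
  · have h3 := _root_.map_dvd (shearHom κ 1) h2
    rw [shearHom_one_rename, shearHom_one_shearHom_neg_one] at h3
    refine hdeg (Nat.le_zero.1 ?_)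
    simpa using natDegree_le_of_dvd h3 (C_ne_zero.2 hd)
  · rw [C_dvd_iff_dvd_coeff] at h2
    replace h2 := h2 0
    rw [coeff_C_zero] at h2
    have h3 := _root_.map_dvd (MvPolynomial.aeval (R := F)
      (Sum.elim 0 MvPolynomial.X : κ ⊕ κ → MvPolynomial κ F)) h2
    rw [MvPolynomial.aeval_rename, MvPolynomial.aeval_rename, Sum.elim_comp_inr,
      MvPolynomial.aeval_X_left_apply, MvPolynomial.aeval_X_left_apply] at h3
    exact hab h3

variable {ι : Type*} [Fintype ι] [DecidableEq ι]

/-- Let `q` be an anisotropic form over a field `K`, and let a polynomial vector be an isotropic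
vector of `q` modulo a quadratic polynomial with constant term `a` and leading coefficient `b`.
Then `q` represents `c a` and `c b` for some `c ≠ 0`: reduce the vector to a vector `x + t y`, so
that `q (x + t y)` is a constant multiple of the polynomial, and compare coefficients. -/
theorem exists_common_slot_of_dvd {K : Type*} [Field K] [Algebra F K] {M : Matrix ι ι F}
    (hM : ∀ x, coordForm M K x = 0 → x = 0) {a β b : K} (hb : b ≠ 0) {P : K[X]}
    (hP : P = C a + X * C β + X ^ 2 * C b) {g : ι → K[X]} (hg : P ∣ coordForm M K[X] g)
    {i₀ : ι} (hi₀ : ¬P ∣ g i₀) :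
    ∃ (c : K) (x y : ι → K), c ≠ 0 ∧ coordForm M K x = c * a ∧ coordForm M K y = c * b := by
  have hPdeg : P.natDegree = 2 := by
    rw [hP]
    compute_degree!
  have hP0 : P ≠ 0 := fun h => by simp [h] at hPdeg
  -- the remainder of the vector modulo `P`, with entries of degree at most one
  let r : ι → K[X] := fun i => g i % P
  have hrP : P ∣ coordForm M K[X] r := by
    have h1 : r = g + P • fun i => -(g i / P) := by
      ext1 i
      have := EuclideanDomain.div_add_mod (g i) P
      simp only [r, Pi.add_apply, Pi.smul_apply, smul_eq_mul]
      linear_combination this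
    rw [h1, QuadraticMap.map_add (coordForm M K[X]), QuadraticMap.map_smul,
      QuadraticMap.polar_smul_right, smul_eq_mul, smul_eq_mul, mul_assoc]
    exact dvd_add (dvd_add hg (dvd_mul_right _ _)) (dvd_mul_right _ _)
  let x : ι → K := fun i => (r i).coeff 0
  let y : ι → K := fun i => (r i).coeff 1
  have hrxy : r = fun i => C (x i) + X * C (y i) := by
    ext1 i
    have h1 : (r i).natDegree ≤ 1 := by
      have := natDegree_mod_lt (g i) (q := P) (by rw [hPdeg]; decide)
      simp only [r]
      omega
    conv_lhs => rw [eq_X_add_C_of_natDegree_le_one h1]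
    ring
  have hq := coordForm_line M x y
  rw [← hrxy] at hq
  obtain ⟨c₀, hc₀⟩ := hrP
  obtain ⟨c, rfl⟩ : ∃ c, c₀ = C c := by
    by_cases h0 : c₀ = 0
    · exact ⟨0, by rw [h0, C_0]⟩
    · refine ⟨c₀.coeff 0, eq_C_of_natDegree_eq_zero ?_⟩
      have h1 : (coordForm M K[X] r).natDegree ≤ 2 := by
        rw [hq]
        compute_degree
      rw [hc₀, natDegree_mul hP0 h0, hPdeg] at h1
      omega
  rw [hc₀, hP] at hq
  have hqx : coordForm M K x = c * a := by
    have := congrArg (fun q => coeff q 0) hq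
    simp [coeff_X_pow] at this
    rw [← this, mul_comm]
  have hqy : coordForm M K y = c * b := by
    have := congrArg (fun q => coeff q 2) hq
    simp [coeff_X_pow] at this
    rw [← this, mul_comm]
  refine ⟨c, x, y, ?_, hqx, hqy⟩
  rintro rfl
  rw [zero_mul] at hqx hqy
  refine hi₀ ((EuclideanDomain.mod_eq_zero).1 ((congrFun hrxy i₀).trans ?_))
  simp [hM x hqx, hM y hqy]

/-- The conclusion of `exists_common_slot_of_dvd` descends from a field of fractions. -/
theorem exists_common_slot_integral {A K : Type*} [CommRing A] [IsDomain A] [Field K] [Algebra A K]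
    [IsFractionRing A K] [Algebra F A] [Algebra F K] [IsScalarTower F A K] {M : Matrix ι ι F}
    {a b : A} {c : K} {x y : ι → K} (hc : c ≠ 0) (hx : coordForm M K x = c * algebraMap A K a)
    (hy : coordForm M K y = c * algebraMap A K b) :
    ∃ (c : A) (x y : ι → A), c ≠ 0 ∧ coordForm M A x = c * a ∧ coordForm M A y = c * b := by
  obtain ⟨d, e, hd, he⟩ := exists_common_denominator (D := A) (Sum.elim x y)
  obtain ⟨c₁, c₂, hc₂, rfl⟩ := IsFractionRing.div_surjective (A := A) c
  have hinj : Function.Injective (algebraMap A K) := IsFractionRing.injective A K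
  have hc₂' : algebraMap A K c₂ ≠ 0 := by simpa using nonZeroDivisors.ne_zero hc₂
  have hc₁ : c₁ ≠ 0 := by rintro rfl; simp at hc
  have key : ∀ (w : ι → K) (w' : ι → A) (l : A),
      (∀ i, algebraMap A K (w' i) = algebraMap A K d * w i) →
      coordForm M K w = algebraMap A K c₁ / algebraMap A K c₂ * algebraMap A K l →
      coordForm M A (c₂ • w') = c₂ * d ^ 2 * c₁ * l := by
    intro w w' l hw hl
    apply hinj
    have h1 := coordForm_comp M (IsScalarTower.toAlgHom F A K) (c₂ • w')
    rw [IsScalarTower.coe_toAlgHom'] at h1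
    have h2 : (fun i => algebraMap A K ((c₂ • w') i)) =
        (algebraMap A K c₂ * algebraMap A K d) • w := by
      ext1 i
      simp [hw, mul_assoc]
    rw [← h1, h2, QuadraticMap.map_smul, hl]
    simp only [map_mul, map_pow, smul_eq_mul]
    field_simp
  refine ⟨c₂ * d ^ 2 * c₁, c₂ • fun i => e (Sum.inl i), c₂ • fun i => e (Sum.inr i),
    mul_ne_zero (mul_ne_zero (nonZeroDivisors.ne_zero hc₂) (pow_ne_zero _ hd)) hc₁,
    key x _ a (fun i => he (Sum.inl i)) hx, key y _ b (fun i => he (Sum.inr i)) hy⟩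

/-- If `P` divides no multiple of `g` by a nonzero constant, then it does not divide `g` over the
field of fractions either. -/
theorem not_dvd_map_of_not_dvd {A K : Type*} [CommRing A] [IsDomain A] [Field K] [Algebra A K]
    [IsFractionRing A K] {P g : A[X]} (h : ∀ d : A, d ≠ 0 → ¬P ∣ C d * g) :
    ¬P.map (algebraMap A K) ∣ g.map (algebraMap A K) := by
  rintro ⟨s, hs⟩
  obtain ⟨d, hd, hds⟩ := IsLocalization.integerNormalization_spec (nonZeroDivisors A) s
  refine h d (nonZeroDivisors.ne_zero hd)
    ⟨IsLocalization.integerNormalization (nonZeroDivisors A) s, ?_⟩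
  refine Polynomial.map_injective _ (IsFractionRing.injective A K) ?_
  rw [Polynomial.map_mul, Polynomial.map_mul, hds, hs, map_C, Algebra.smul_def,
    Polynomial.algebraMap_apply]
  ring

/-- The version of `exists_common_slot_of_dvd` for a domain in place of a field. -/
theorem exists_common_slot_of_dvd_integral {A : Type*} (K : Type*) [CommRing A] [IsDomain A]
    [Field K] [Algebra A K] [IsFractionRing A K] [Algebra F A] [Algebra F K] [IsScalarTower F A K]
    {M : Matrix ι ι F} (hM : ∀ x, coordForm M A x = 0 → x = 0) {a β b : A} (hb : b ≠ 0) {P : A[X]}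
    (hP : P = C a + X * C β + X ^ 2 * C b) {g : ι → A[X]} (hg : P ∣ coordForm M A[X] g)
    {i₀ : ι} (hi₀ : ∀ d : A, d ≠ 0 → ¬P ∣ C d * g i₀) :
    ∃ (c : A) (x y : ι → A), c ≠ 0 ∧ coordForm M A x = c * a ∧ coordForm M A y = c * b := by
  let m : A[X] →ₐ[F] K[X] := Polynomial.mapAlgHom (IsScalarTower.toAlgHom F A K)
  have hg' : m P ∣ coordForm M K[X] (fun i => m (g i)) := by
    rw [coordForm_comp M m g]
    exact _root_.map_dvd m hg
  obtain ⟨c, x, y, hc, hx, hy⟩ := exists_common_slot_of_dvd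
    (anisotropic_fractionField (K := K) M hM) (a := algebraMap A K a) (β := algebraMap A K β)
    (b := algebraMap A K b) (by simpa using hb) (by rw [hP]; simp [m]) hg'
    (not_dvd_map_of_not_dvd hi₀)
  exact exists_common_slot_integral hc hx hy

variable [Fintype κ] [DecidableEq κ]

/-- Let `p` be a form whose polynomial is prime, and let `q` be an anisotropic form that becomes
isotropic modulo this polynomial. Then `q` represents `c p(X)` and `c p(Y)` over `F[X, Y]` for some
`c ≠ 0`. -/
theorem exists_generic_common_slot {M : Matrix ι ι F} {N : Matrix κ κ F}
    (hM : ∀ x, coordForm M F x = 0 → x = 0)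
    (hN : Prime (coordForm N (MvPolynomial κ F) MvPolynomial.X))
    {f : ι → MvPolynomial κ F}
    (hf : coordForm N (MvPolynomial κ F) MvPolynomial.X ∣ coordForm M (MvPolynomial κ F) f)
    {i₀ : ι} (hi₀ : ¬coordForm N (MvPolynomial κ F) MvPolynomial.X ∣ f i₀) :
    ∃ (c : MvPolynomial (κ ⊕ κ) F) (x y : ι → MvPolynomial (κ ⊕ κ) F), c ≠ 0 ∧
      coordForm M _ x = c * coordForm N _ (fun j => MvPolynomial.X (Sum.inr j)) ∧
      coordForm M _ y = c * coordForm N _ (fun j => MvPolynomial.X (Sum.inl j)) := by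
  set p := coordForm N (MvPolynomial κ F) MvPolynomial.X with hp
  set pX := coordForm N (MvPolynomial (κ ⊕ κ) F) (fun j => MvPolynomial.X (Sum.inr j))
  set pY := coordForm N (MvPolynomial (κ ⊕ κ) F) (fun j => MvPolynomial.X (Sum.inl j)) with hpY
  have hpY0 : pY ≠ 0 := by
    have h : pY = MvPolynomial.rename Sum.inl p := by
      rw [hp, ← coordForm_comp]
      simp [hpY]
    rw [h]
    exact fun h0 =>
      hN.ne_zero (MvPolynomial.rename_injective _ Sum.inl_injective (by simpa using h0))
  obtain ⟨β, hβ⟩ : ∃ β, lineHom F κ p = C pX + X * C β + X ^ 2 * C pY := by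
    refine ⟨QuadraticMap.polar (coordForm N _) (fun j => MvPolynomial.X (Sum.inr j))
      (fun j => MvPolynomial.X (Sum.inl j)), ?_⟩
    rw [hp, ← coordForm_comp]
    simp only [lineHom, MvPolynomial.aeval_X]
    exact coordForm_line N _ _
  have hdeg : (lineHom F κ p).natDegree ≠ 0 := by
    have : (lineHom F κ p).natDegree = 2 := by
      rw [hβ]
      compute_degree!
    omega
  have hg : lineHom F κ p ∣ coordForm M _ (fun i => lineHom F κ (f i)) := by
    rw [coordForm_comp M (lineHom F κ) f]
    exact _root_.map_dvd (lineHom F κ) hf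
  exact exists_common_slot_of_dvd_integral (FractionRing (MvPolynomial (κ ⊕ κ) F))
    (anisotropic_mvPolynomial M hM) hpY0 hβ hg fun d hd => lineHom_not_dvd hN hi₀ hdeg hd

end GenericLine

/-! ### Products of two values over arbitrary extensions -/

section ProductsOfValues

open Polynomial

variable {F : Type*} [Field F] {ι κ : Type*} [Fintype ι] [DecidableEq ι] [Fintype κ]
  [DecidableEq κ]

theorem coordForm_map (M : Matrix ι ι F) (E : Type*) {R : Type*} [Field E] [Algebra F E]
    [CommRing R] [Algebra F R] [Algebra E R] [IsScalarTower F E R] :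
    coordForm (M.map (algebraMap F E)) R = coordForm M R := by
  ext x
  simp [coordForm_apply, ← IsScalarTower.algebraMap_apply]

/-- If `q` represents `c p(X)` and `c p(Y)` for some `c ≠ 0`, then over every extension the product
of two nonzero values of `p` is a product of two values of `q`. -/
theorem exists_mul_eq_of_generic_common_slot {M : Matrix ι ι F} {N : Matrix κ κ F}
    {c : MvPolynomial (κ ⊕ κ) F} {x y : ι → MvPolynomial (κ ⊕ κ) F} (hc : c ≠ 0)
    (hx : coordForm M _ x = c * coordForm N _ (fun j => MvPolynomial.X (Sum.inr j)))
    (hy : coordForm M _ y = c * coordForm N _ (fun j => MvPolynomial.X (Sum.inl j)))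
    {E : Type*} [Field E] [Algebra F E] {v w : κ → E} (hv : coordForm N E v ≠ 0)
    (hw : coordForm N E w ≠ 0) :
    ∃ z z', coordForm M E z * coordForm M E z' = coordForm N E v * coordForm N E w := by
  have hc' : MvPolynomial.map (algebraMap F E) c ≠ 0 := fun h =>
    hc (MvPolynomial.map_injective _ (algebraMap F E).injective (by rw [h, map_zero]))
  obtain ⟨γ, hγ0, hγ⟩ := exists_curve hc' (Sum.elim w v)
  rw [MvPolynomial.aeval_map_algebraMap] at hγ
  let h : MvPolynomial (κ ⊕ κ) F →ₐ[F] E[X] := MvPolynomial.aeval γ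
  have hval : ∀ e : κ → κ ⊕ κ, h (coordForm N _ fun j => MvPolynomial.X (e j)) =
      coordForm N E[X] fun j => γ (e j) := fun e => by
    rw [← coordForm_comp N h]
    simp [h]
  have hev : ∀ e : κ → κ ⊕ κ, (coordForm N E[X] fun j => γ (e j)).eval 0 =
      coordForm N E fun j => Sum.elim w v (e j) := fun e => by
    rw [← coordForm_map N E (R := E[X]), ← coordForm_eval, ← coordForm_map N E (R := E)]
    simp only [hγ0]
  have hx' := coordForm_comp M h x
  have hy' := coordForm_comp M h y
  rw [hx, map_mul, hval, ← coordForm_map M E] at hx'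
  rw [hy, map_mul, hval, ← coordForm_map M E] at hy'
  have hv' := hev Sum.inr
  have hw' := hev Sum.inl
  simp only [Sum.elim_inl, Sum.elim_inr] at hv' hw'
  obtain ⟨z, z', hz⟩ := exists_mul_eq_eval_mul_eval (M.map (algebraMap F E))
    (by rwa [hv']) (by rwa [hw']) _ _ _ hγ hx' hy'
  rw [coordForm_map, hv', hw'] at hz
  exact ⟨z, z', hz⟩

end ProductsOfValues

/-! ### Isotropy modulo a prime and the parity of valuations -/

section Parity

variable {F : Type*} [Field F] {ι : Type*} [Fintype ι] [DecidableEq ι] (M : Matrix ι ι F)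

theorem isIsotropic_residueField_iff {R K : Type*} [CommRing R] [Algebra F R] {π : R}
    [IsDomain (R ⧸ Ideal.span {π})] [Field K] [Algebra (R ⧸ Ideal.span {π}) K]
    [IsFractionRing (R ⧸ Ideal.span {π}) K] [Algebra F K]
    [IsScalarTower F (R ⧸ Ideal.span {π}) K] :
    IsIsotropic (coordForm M K) ↔ ∃ f : ι → R, π ∣ coordForm M R f ∧ ∃ i, ¬π ∣ f i := by
  let D := R ⧸ Ideal.span {π}
  let mk : R →ₐ[F] D := Ideal.Quotient.mkₐ F (Ideal.span {π})
  have hmk : ∀ a, mk a = 0 ↔ π ∣ a := fun a => by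
    rw [← Ideal.mem_span_singleton]
    exact Ideal.Quotient.eq_zero_iff_mem
  constructor
  · rintro ⟨x, hx0, hx⟩
    by_contra! hall
    refine hx0 (anisotropic_fractionField (D := D) M (fun g hg => ?_) x hx)
    obtain ⟨f, rfl⟩ : ∃ f : ι → R, (fun i => mk (f i)) = g :=
      ⟨fun i => (Ideal.Quotient.mk_surjective (g i)).choose,
        funext fun i => (Ideal.Quotient.mk_surjective (g i)).choose_spec⟩
    rw [coordForm_comp M mk f, hmk] at hg
    exact funext fun i => (hmk _).2 (hall f hg i)
  · rintro ⟨f, hf, i, hi⟩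
    refine ⟨fun i => IsScalarTower.toAlgHom F D K (mk (f i)), fun h => hi ?_, ?_⟩
    · have h1 : algebraMap D K (mk (f i)) = 0 := congrFun h i
      rwa [FaithfulSMul.algebraMap_eq_zero_iff, hmk] at h1
    · rw [coordForm_comp M _ fun i => mk (f i), coordForm_comp M mk f, (hmk _).2 hf, map_zero]

/-- The units of the field of fractions `K` of `R` with even valuation at the prime `π`, described
as the units `r ^ 2 * u / d` with `r` in `K` and `u`, `d` in `R` prime to `π`. -/
def evenUnits {R : Type*} (K : Type*) [CommRing R] [IsDomain R] [Field K] [Algebra R K]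
    [IsFractionRing R K] {π : R} (hπ : Prime π) : Subgroup Kˣ where
  carrier := {z | ∃ (r : K) (u d : R), ¬π ∣ u ∧ ¬π ∣ d ∧
    (z : K) * algebraMap R K d = r ^ 2 * algebraMap R K u}
  one_mem' := ⟨1, 1, 1, hπ.not_dvd_one, hπ.not_dvd_one, by simp⟩
  mul_mem' := by
    rintro z z' ⟨r, u, d, hu, hd, h⟩ ⟨r', u', d', hu', hd', h'⟩
    refine ⟨r * r', u * u', d * d', hπ.not_dvd_mul hu hu', hπ.not_dvd_mul hd hd', ?_⟩
    rw [Units.val_mul, map_mul, map_mul]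
    linear_combination z' * algebraMap R K d' * h + r ^ 2 * algebraMap R K u * h'
  inv_mem' := by
    rintro z ⟨r, u, d, hu, hd, h⟩
    refine ⟨r⁻¹, d, u, hd, hu, ?_⟩
    have hd0 : algebraMap R K d ≠ 0 := by
      simpa using fun h0 : d = 0 => hd (h0 ▸ dvd_zero π)
    have hr : r ≠ 0 := by
      rintro rfl
      simp [hd0] at h
    rw [Units.val_inv_eq_inv_val, inv_mul_eq_iff_eq_mul₀ z.ne_zero]
    field_simp
    linear_combination -h

variable {R K : Type*} [CommRing R] [IsDomain R] [Field K] [Algebra R K] [IsFractionRing R K]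
  [WfDvdMonoid R] {π : R} (hπ : Prime π)

theorem notMem_evenUnits {a : R} (ha : ¬π ∣ a) {z : Kˣ} (hz : (z : K) = algebraMap R K (π * a)) :
    z ∉ evenUnits K hπ := by
  rintro ⟨r, u, d, hu, hd, h⟩
  obtain ⟨g, l, hl, rfl⟩ := IsFractionRing.div_surjective (A := R) r
  have hl0 : l ≠ 0 := nonZeroDivisors.ne_zero hl
  have hl' : algebraMap R K l ≠ 0 := by simpa using hl0
  have h1 : π * a * d * l ^ 2 = g ^ 2 * u := by
    apply IsFractionRing.injective R K
    rw [hz] at h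
    field_simp at h
    simpa using h
  have hne : ∀ {t : R}, ¬π ∣ t → t ≠ 0 := fun ht h0 => ht (h0 ▸ dvd_zero π)
  have hL : π * a * d * l ^ 2 ≠ 0 :=
    mul_ne_zero (mul_ne_zero (mul_ne_zero hπ.ne_zero (hne ha)) (hne hd)) (pow_ne_zero _ hl0)
  have hfin : ∀ {t : R}, t ≠ 0 → FiniteMultiplicity π t :=
    fun ht => FiniteMultiplicity.of_not_isUnit hπ.not_isUnit ht
  have h2 := congrArg (multiplicity π) h1
  have hg0 : g ≠ 0 := by
    rintro rfl
    exact hL (by rw [h1]; ring)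
  rw [multiplicity_mul hπ (hfin hL), multiplicity_mul hπ (hfin (left_ne_zero_of_mul hL)),
    multiplicity_mul hπ (hfin (left_ne_zero_of_mul (left_ne_zero_of_mul hL))),
    multiplicity_mul hπ (hfin (h1 ▸ hL)), (hfin hl0).multiplicity_pow hπ,
    (hfin hg0).multiplicity_pow hπ, multiplicity_self, multiplicity_eq_zero.2 ha,
    multiplicity_eq_zero.2 hd, multiplicity_eq_zero.2 hu] at h2
  omega

/-- If a form is anisotropic modulo the prime `π`, then its nonzero values have even valuation at
`π`. -/
theorem repGroup_le_evenUnits [Algebra F R] [Algebra F K] [IsScalarTower F R K]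
    (hM : ∀ f : ι → R, π ∣ coordForm M R f → ∀ i, π ∣ f i) :
    repGroup (coordForm M K) ≤ evenUnits K hπ := by
  rw [repGroup, Subgroup.closure_le]
  rintro z ⟨x, hx⟩
  obtain ⟨d, f, hd, hf⟩ := exists_common_denominator (D := R) x
  have hd' : algebraMap R K d ≠ 0 := by simpa using hd
  have hf0 : f ≠ 0 := by
    rintro rfl
    refine z.ne_zero ?_
    have hx0 : x = 0 := funext fun i => by
      have h3 := hf i
      rw [Pi.zero_apply, map_zero, eq_comm, mul_eq_zero] at h3
      exact h3.resolve_left hd'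
    rw [← hx, hx0, QuadraticMap.map_zero]
  obtain ⟨k, g, hg, i, hi⟩ := exists_eq_pow_mul_not_dvd hπ hf0
  refine ⟨algebraMap R K (π ^ k) / algebraMap R K d, coordForm M R g, 1,
    fun h => hi (hM g h i), hπ.not_dvd_one, ?_⟩
  have h1 : x = (algebraMap R K (π ^ k) / algebraMap R K d) •
      fun i => IsScalarTower.toAlgHom F R K (g i) := by
    ext1 i
    have := hf i
    rw [hg i, map_mul] at this
    simp only [Pi.smul_apply, smul_eq_mul, IsScalarTower.coe_toAlgHom']
    field_simp
    linear_combination -this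
  rw [← hx, h1, QuadraticMap.map_smul, coordForm_comp M _ g, map_one, mul_one, smul_eq_mul, sq]
  rfl

end Parity

/-! ### Reducible quadratic forms -/

section Reducible

open MvPolynomial

variable {F : Type*} [Field F] {κ : Type*} [Fintype κ]

theorem exists_eq_C_add_linear {g : MvPolynomial κ F} (hg : g.totalDegree ≤ 1) :
    ∃ c : κ → F, g = C (eval 0 g) + ∑ i, C (c i) * X i := by
  have h1 : homogeneousComponent 1 g ∈ homogeneousSubmodule κ F 1 :=
    homogeneousComponent_mem 1 g
  rw [homogeneousSubmodule_one_eq_span_X, Submodule.mem_span_range_iff_exists_fun] at h1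
  obtain ⟨c, hc⟩ := h1
  refine ⟨c, ?_⟩
  have h2 : g = homogeneousComponent 0 g + homogeneousComponent 1 g := by
    conv_lhs => rw [← sum_homogeneousComponent g]
    rcases Nat.le_one_iff_eq_zero_or_eq_one.1 hg with h | h
    · rw [h, homogeneousComponent_eq_zero 1 g (by omega)]
      simp
    · rw [h]
      simp [Finset.sum_range_succ]
  have h3 : eval 0 g = coeff 0 g := by
    rw [eval_zero, constantCoeff_eq]
  conv_lhs => rw [h2, homogeneousComponent_zero, ← hc]
  rw [h3]
  simp [smul_eq_C_mul]

/-- The polynomial ring modulo a linear form embeds in the polynomial ring. -/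
theorem exists_algHom_eq_zero_iff_dvd {c : κ → F} {i₀ : κ} (hi₀ : c i₀ ≠ 0) :
    ∃ σ : MvPolynomial κ F →ₐ[F] MvPolynomial κ F, ∀ f, σ f = 0 ↔ ∑ i, C (c i) * X i ∣ f := by
  classical
  set g : MvPolynomial κ F := ∑ i, C (c i) * X i with hg
  let σ : MvPolynomial κ F →ₐ[F] MvPolynomial κ F :=
    aeval fun j => X j - if j = i₀ then C (c i₀)⁻¹ * g else 0
  have hσg : σ g = 0 := by
    have h1 : σ g = ∑ i, C (c i) * (X i - if i = i₀ then C (c i₀)⁻¹ * g else 0) := by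
      conv_lhs => rw [hg, map_sum]
      refine Finset.sum_congr rfl fun i _ => ?_
      rw [map_mul]
      congr 1
      · exact σ.commutes (c i)
      · exact aeval_X _ _
    have h2 : σ g = g - C (c i₀) * (C (c i₀)⁻¹ * g) := by
      rw [h1]
      simp only [mul_sub, Finset.sum_sub_distrib, mul_ite, mul_zero, Finset.sum_ite_eq',
        Finset.mem_univ, if_true, ← hg]
    rw [h2, ← mul_assoc, ← C_mul, mul_inv_cancel₀ hi₀]
    simp
  have hσ : ∀ f, g ∣ f - σ f := fun f => by
    induction f using MvPolynomial.induction_on with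
    | C r => simp [σ, algebraMap_eq]
    | add p q hp hq =>
      rw [map_add, add_sub_add_comm]
      exact dvd_add hp hq
    | mul_X p j hp =>
      have h1 : g ∣ X j - σ (X j) := by
        simp only [σ, aeval_X, sub_sub_cancel]
        split_ifs
        · exact dvd_mul_left _ _
        · exact dvd_zero _
      rw [map_mul, show p * X j - σ p * σ (X j) = (p - σ p) * X j + σ p * (X j - σ (X j)) by ring]
      exact dvd_add (hp.mul_right _) (h1.mul_left _)
  refine ⟨σ, fun f => ⟨fun h => ?_, ?_⟩⟩
  · simpa [h] using hσ f
  · rintro ⟨k, rfl⟩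
    rw [map_mul, hσg, zero_mul]

variable [DecidableEq κ]

theorem isHomogeneous_coordForm_X (N : Matrix κ κ F) :
    (coordForm N (MvPolynomial κ F) X).IsHomogeneous 2 := by
  rw [coordForm_apply]
  refine IsHomogeneous.sum _ _ _ fun i _ => IsHomogeneous.sum _ _ _ fun j _ => ?_
  exact ((isHomogeneous_X F i).mul (isHomogeneous_C κ (N i j))).mul (isHomogeneous_X F j)

theorem eval_coordForm_X (N : Matrix κ κ F) (x : κ → F) :
    eval x (coordForm N (MvPolynomial κ F) X) = coordForm N F x := by
  have := coordForm_comp N (aeval x : MvPolynomial κ F →ₐ[F] F) X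
  simpa using this.symm

/-- If the polynomial of a nondefective form in at least two variables is the product of two
polynomials of degree one, the first of them a linear form, then the square of this linear form does
not divide it: otherwise the kernel of the linear form would lie in the radical. -/
theorem not_dvd_of_mul_eq_coordForm {N : Matrix κ κ F} (hN : (coordForm N F).radical = ⊥)
    (hκ : 2 ≤ Fintype.card κ) {c : κ → F} {h : MvPolynomial κ F} (hh : h.totalDegree = 1)
    (hg1 : (∑ i, C (c i) * X i : MvPolynomial κ F).totalDegree = 1)
    (hgh : coordForm N (MvPolynomial κ F) X = (∑ i, C (c i) * X i) * h) :
    ¬(∑ i, C (c i) * X i : MvPolynomial κ F) ∣ h := by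
  rintro ⟨k, rfl⟩
  have hne : (∑ i, C (c i) * X i : MvPolynomial κ F) * k ≠ 0 := fun h0 => by simp [h0] at hh
  have hk : k.totalDegree = 0 := by
    rw [totalDegree_mul_of_isDomain (left_ne_zero_of_mul hne) (right_ne_zero_of_mul hne),
      hg1] at hh
    omega
  rw [totalDegree_eq_zero_iff_eq_C] at hk
  set l : F := coeff 0 k
  let L : (κ → F) →ₗ[F] F := ∑ i, c i • LinearMap.proj i
  have hval : ∀ x, coordForm N F x = l * L x ^ 2 := fun x => by
    rw [← eval_coordForm_X, hgh, hk]
    simp [L]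
    ring
  have hker : LinearMap.ker L ≠ ⊥ := LinearMap.ker_ne_bot_of_finrank_lt (by
    rw [Module.finrank_self, Module.finrank_fintype_fun_eq_card]
    omega)
  obtain ⟨x, hx, hx0⟩ := Submodule.exists_mem_ne_zero_of_ne_bot hker
  rw [LinearMap.mem_ker] at hx
  refine hx0 ((Submodule.mem_bot F).1 (hN ▸ ?_))
  rw [mem_radical_iff_polar]
  refine ⟨by simp [hval, hx], fun y => ?_⟩
  simp [QuadraticMap.polar, hval, hx]

/-- If the polynomial of a nondefective form in at least two variables is reducible, it has a linear
factor `π` of multiplicity one. The kernel of the endomorphism `σ` is the ideal generated by `π`. -/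
theorem exists_prime_linear_factor {N : Matrix κ κ F} (hN : (coordForm N F).radical = ⊥)
    (hκ : 2 ≤ Fintype.card κ) (hirr : ¬Irreducible (coordForm N (MvPolynomial κ F) X)) :
    ∃ (π h : MvPolynomial κ F) (σ : MvPolynomial κ F →ₐ[F] MvPolynomial κ F), Prime π ∧
      coordForm N (MvPolynomial κ F) X = π * h ∧ ¬π ∣ h ∧ ∀ f, σ f = 0 ↔ π ∣ f := by
  have hne : coordForm N (MvPolynomial κ F) X ≠ 0 := fun h0 => by
    have hzero : ∀ x, coordForm N F x = 0 := fun x => by rw [← eval_coordForm_X, h0, map_zero]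
    have : Nonempty κ := Fintype.card_pos_iff.1 (by omega)
    have h1 : (1 : κ → F) ∈ (coordForm N F).radical := by
      rw [mem_radical_iff_polar]
      simp [QuadraticMap.polar, hzero]
    rw [hN, Submodule.mem_bot] at h1
    exact one_ne_zero h1
  have hdeg := (isHomogeneous_coordForm_X N).totalDegree hne
  have hunit : ∀ p : MvPolynomial κ F, p ≠ 0 → ¬IsUnit p → p.totalDegree ≠ 0 := fun p hp hu h0 => by
    rw [totalDegree_eq_zero_iff_eq_C] at h0
    rw [h0] at hu hp
    exact hu ((isUnit_iff_ne_zero.2 fun h => hp (by rw [h, C_0])).map C)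
  have hnu : ¬IsUnit (coordForm N (MvPolynomial κ F) X) := fun hu => by
    have := (isUnit_iff_totalDegree_of_isReduced.1 hu).2
    omega
  obtain ⟨g, h, hgh, hgu, hhu⟩ : ∃ g h, coordForm N (MvPolynomial κ F) X = g * h ∧
      ¬IsUnit g ∧ ¬IsUnit h := by
    by_contra! hall
    exact hirr ⟨hnu, fun g h hgh => or_iff_not_imp_left.2 fun hg => hall g h hgh hg⟩
  rw [hgh] at hne
  have hg1 := hunit g (left_ne_zero_of_mul hne) hgu
  have hh1 := hunit h (right_ne_zero_of_mul hne) hhu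
  rw [hgh, totalDegree_mul_of_isDomain (left_ne_zero_of_mul hne) (right_ne_zero_of_mul hne)] at hdeg
  -- the form vanishes at the origin, hence so does one of the two factors
  wlog hg0 : eval 0 g = 0 generalizing g h
  · refine this h g (by omega) (by rwa [mul_comm]) (by rw [hgh, mul_comm]) hhu hgu hh1 hg1 ?_
    have h1 := eval_coordForm_X N 0
    rw [hgh, map_mul, QuadraticMap.map_zero] at h1
    exact (mul_eq_zero.1 h1).resolve_left hg0
  obtain ⟨c, hc⟩ := exists_eq_C_add_linear (g := g) (by omega)
  rw [hg0, C_0, zero_add] at hc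
  obtain ⟨i₀, hi₀⟩ : ∃ i, c i ≠ 0 := by
    by_contra! hall
    exact left_ne_zero_of_mul hne (by rw [hc]; simp [hall])
  obtain ⟨σ, hσ⟩ := exists_algHom_eq_zero_iff_dvd hi₀
  rw [← hc] at hσ
  refine ⟨g, h, σ, ⟨left_ne_zero_of_mul hne, hgu, fun a b hab => ?_⟩, hgh, ?_, hσ⟩
  · rw [← hσ, map_mul, mul_eq_zero] at hab
    rwa [← hσ, ← hσ]
  · rw [hc] at hgh hg1 hdeg ⊢
    exact not_dvd_of_mul_eq_coordForm hN hκ (by omega) (by omega) hgh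

end Reducible

/-! ### The function field of a quadratic form -/

section FunctionFieldForms

variable {F : Type u} [Field F] {V : Type v₁} [AddCommGroup V] [Module F V]
  {W : Type v₂} [AddCommGroup W] [Module F W]

theorem repSqGroup_le_repGroup (φ : QuadraticForm F V) : repSqGroup φ ≤ repGroup φ := by
  rw [repSqGroup, Subgroup.closure_le, sq]
  rintro _ ⟨c₁, hc₁, c₂, hc₂, rfl⟩
  exact mul_mem (Subgroup.subset_closure hc₁) (Subgroup.subset_closure hc₂)

theorem repUnits_extend_of_isIsotropic [FiniteDimensional F V] {φ : QuadraticForm F V}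
    (hφ : IsNondefective φ) (h : IsIsotropic φ) (E : Type w) [Field E] [Algebra F E] :
    repUnits (extend E φ) = Set.univ := by
  obtain ⟨x, hx0, hx⟩ := h
  have hr : x ∉ φ.radical := by
    rwa [isNondefective_iff_radical.1 hφ, Submodule.mem_bot]
  rw [mem_radical_iff_polar] at hr
  push Not at hr
  obtain ⟨y, hy⟩ := hr hx
  refine Set.eq_univ_of_forall fun c => ?_
  refine exists_eq_of_isotropic_not_mem_radical (x := (1 : E) ⊗ₜ[F] x)
    (by rw [extend_tmul, hx, map_zero, mul_zero]) (fun hmem => hy ?_) (c : E)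
  have h1 := ((mem_radical_iff_polar _ _).1 hmem).2 ((1 : E) ⊗ₜ[F] y)
  simpa [polar_extend_tmul] using h1

theorem map_mem_repUnits (φ : QuadraticForm F V) {E E' : Type*} [Field E] [Algebra F E] [Field E']
    [Algebra F E'] [FiniteDimensional F V] (h : E →ₐ[F] E') {c : Eˣ}
    (hc : c ∈ repUnits (extend E φ)) :
    Units.map (h : E →* E') c ∈ repUnits (extend E' φ) := by
  rw [← repUnits_congr (extendIsometry _ φ (Module.finBasis F V))] at hc ⊢
  obtain ⟨x, hx⟩ := hc
  exact ⟨_, (coordForm_comp _ h x).trans (by rw [hx]; rfl)⟩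

theorem extend_smul (E : Type w) [Field E] [Algebra F E] (a : F) (ψ : QuadraticForm F W) :
    extend E (a • ψ) = algebraMap F E a • extend E ψ := by
  refine (extend_unique E _ _ fun x => ?_).symm
  simp [extend_tmul, Algebra.smul_def]

theorem mem_repUnits_extend (E : Type w) [Field E] [Algebra F E] {ψ : QuadraticForm F W} {a : Fˣ}
    (ha : a ∈ repUnits ψ) : Units.map (algebraMap F E : F →* E) a ∈ repUnits (extend E ψ) := by
  obtain ⟨x, hx⟩ := ha
  refine ⟨(1 : E) ⊗ₜ[F] x, ?_⟩
  rw [extend_tmul, hx, one_pow, one_mul]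
  rfl

theorem mem_repUnits_extend_smul_iff (E : Type w) [Field E] [Algebra F E] (ψ : QuadraticForm F W)
    (a : Fˣ) (c : Eˣ) : Units.map (algebraMap F E : F →* E) a * c ∈
      repUnits (extend E ((a : F) • ψ)) ↔ c ∈ repUnits (extend E ψ) := by
  have ha : algebraMap F E (a : F) ≠ 0 := by simp
  simp [repUnits, extend_smul, ha, -algebraMap_smul]

/-- Forms stay nondefective over the rational function field. -/
theorem isNondefective_extend_ratField [FiniteDimensional F V] {φ : QuadraticForm F V}
    (hφ : IsNondefective φ) (n : ℕ) :
    IsNondefective (extend (ULift.{w} (RatField F n)) φ) := by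
  let e := Module.finBasis F V
  rw [← isNondefective_congr (coordIsometry φ e), isNondefective_iff_radical] at hφ
  rw [← isNondefective_congr (extendIsometry _ φ e), isNondefective_iff_radical, eq_bot_iff]
  intro x hx
  let h : ULift.{w} (RatField F n) →ₐ[F] RatField F n := (ULift.algEquiv (R := F)).toAlgHom
  have h1 := radical_rationalFunctionField (σ := Fin n) _ hφ
  have h2 : (fun i => h (x i)) ∈ (coordForm (gram φ e) (RatField F n)).radical := by
    rw [mem_radical_iff_polar]
    exact ⟨(comp_mem_radical _ h hx 0).1, fun y => (comp_mem_radical _ h hx y).2⟩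
  rw [h1, Submodule.mem_bot] at h2
  exact (Submodule.mem_bot _).2 (funext fun i => ULift.down_injective (congrFun h2 i))

section Generic

variable {n : ℕ} (b : Module.Basis (Fin n) F W) (ψ : QuadraticForm F W)

theorem formPoly_ne_zero {a : Fˣ} (ha : a ∈ repUnits ψ) : formPoly ψ b ≠ 0 := by
  obtain ⟨x, hx⟩ := ha
  intro h0
  have h1 := eval_formPoly ψ b (b.repr x)
  rw [h0, map_zero, b.sum_repr, hx] at h1
  exact a.ne_zero h1.symm

/-- The generic value `ψ(X)` is a value of `ψ` over the field of rational functions. -/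
theorem exists_generic_value {a : Fˣ} (ha : a ∈ repUnits ψ) : ∃ g : (RatField F n)ˣ,
    g ∈ repUnits (extend (RatField F n) ψ) ∧
      ((Units.map (algebraMap F (RatField F n) : F →* RatField F n) a * g : (RatField F n)ˣ) :
        RatField F n) = scaledGenericValue a ψ b := by
  have h0 : algebraMap (MvPolynomial (Fin n) F) (RatField F n) (formPoly ψ b) ≠ 0 := by
    simpa using formPoly_ne_zero b ψ ha
  refine ⟨Units.mk0 _ h0, ?_, ?_⟩
  · rw [← repUnits_congr (extendIsometry _ ψ b)]
    refine ⟨_, (coordForm_comp (gram ψ b)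
      (IsScalarTower.toAlgHom F (MvPolynomial (Fin n) F) (RatField F n)) MvPolynomial.X).trans ?_⟩
    rw [← formPoly_eq_coordForm]
    rfl
  · rw [scaledGenericValue, map_mul, Units.val_mul]
    rfl

end Generic

variable {n : ℕ} (b : Module.Basis (Fin n) F W) {φ : QuadraticForm F V}
  {ψ : QuadraticForm F W}

theorem isotropicOverFunctionField_iff_exists {ι : Type*} [Fintype ι] [DecidableEq ι]
    (e : Module.Basis ι F V) (h : Irreducible (formPoly ψ b)) :
    IsotropicOverFunctionField φ ψ b ↔ ∃ f : ι → MvPolynomial (Fin n) F,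
      formPoly ψ b ∣ coordForm (gram φ e) _ f ∧ ∃ i, ¬formPoly ψ b ∣ f i := by
  have := isDomain_quotient h
  rw [IsotropicOverFunctionField, dif_pos h, ← isIsotropic_congr (extendIsometry _ φ e)]
  exact isIsotropic_residueField_iff _

variable [FiniteDimensional F V]

/-- If `φ` becomes isotropic over the function field of `ψ`, then over every extension a product of
two nonzero values of `ψ` is a product of two values of `φ`. -/
theorem repUnits_sq_subset_of_isotropicOverFunctionField (hφ : IsNondefective φ)
    (h : IsotropicOverFunctionField φ ψ b) (E : Type w) [Field E] [Algebra F E] :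
    repUnits (extend E ψ) ^ 2 ⊆ repUnits (extend E φ) ^ 2 := by
  by_cases hiso : IsIsotropic φ
  · intro c _
    rw [repUnits_extend_of_isIsotropic hφ hiso, sq, Set.mem_mul]
    exact ⟨c, trivial, 1, trivial, mul_one c⟩
  let e := Module.finBasis F V
  have hirr : Irreducible (formPoly ψ b) := by
    by_contra hirr
    rw [IsotropicOverFunctionField, dif_neg hirr] at h
    exact hiso h
  obtain ⟨f, hf, i, hi⟩ := (isotropicOverFunctionField_iff_exists b e hirr).1 h
  have hprime := hirr.prime
  rw [formPoly_eq_coordForm] at hf hi hprime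
  have hM : ∀ x, coordForm (gram φ e) F x = 0 → x = 0 := fun x hx => by
    by_contra hx0
    exact hiso ((isIsotropic_congr (coordIsometry φ e)).1 ⟨x, hx0, hx⟩)
  obtain ⟨c, x, y, hc, hx, hy⟩ := exists_generic_common_slot hM hprime hf hi
  rw [← repUnits_congr (extendIsometry E ψ b), ← repUnits_congr (extendIsometry E φ e), sq, sq]
  rintro _ ⟨c₁, ⟨v₁, hv₁⟩, c₂, ⟨v₂, hv₂⟩, rfl⟩
  obtain ⟨z, z', hz⟩ := exists_mul_eq_of_generic_common_slot hc hx hy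
    (hv₁ ▸ c₁.ne_zero) (hv₂ ▸ c₂.ne_zero)
  have hne : coordForm (gram φ e) E z * coordForm (gram φ e) E z' ≠ 0 := by
    rw [hz, hv₁, hv₂]
    exact mul_ne_zero c₁.ne_zero c₂.ne_zero
  refine ⟨Units.mk0 _ (left_ne_zero_of_mul hne), ⟨z, rfl⟩,
    Units.mk0 _ (right_ne_zero_of_mul hne), ⟨z', rfl⟩, Units.ext ?_⟩
  simp [hz, hv₁, hv₂]

/-- If `a ψ(X)` lies in the group generated by the values of `φ`, then `φ` is isotropic over the
function field of `ψ`: otherwise there is a prime factor of `ψ(X)` of multiplicity one at which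
all values of `φ` have even valuation. -/
theorem isotropicOverFunctionField_of_mem_repGroup (hn : 2 ≤ n) (hψ : IsNondefective ψ)
    {a : Fˣ} {q : (RatField F n)ˣ} (hq : q ∈ repGroup (extend (RatField F n) φ))
    (hqa : (q : RatField F n) = scaledGenericValue a ψ b) :
    IsotropicOverFunctionField φ ψ b := by
  have : FiniteDimensional F W := b.finiteDimensional_of_finite
  let e := Module.finBasis F V
  by_contra hni
  rw [repGroup, ← repUnits_congr (extendIsometry _ φ e), ← repGroup] at hq
  have hCa : IsUnit (MvPolynomial.C (a : F) : MvPolynomial (Fin n) F) :=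
    a.isUnit.map MvPolynomial.C
  by_cases hirr : Irreducible (formPoly ψ b)
  · rw [isotropicOverFunctionField_iff_exists b e hirr] at hni
    push Not at hni
    refine notMem_evenUnits hirr.prime (fun hdvd => hirr.not_isUnit (isUnit_of_dvd_unit hdvd hCa))
      ?_ (repGroup_le_evenUnits _ hirr.prime hni hq)
    rw [hqa, scaledGenericValue, mul_comm]
  · rw [IsotropicOverFunctionField, dif_neg hirr] at hni
    rw [← isNondefective_congr (coordIsometry ψ b), isNondefective_iff_radical] at hψ
    rw [formPoly_eq_coordForm] at hirr
    obtain ⟨π, h, σ, hπ, hπh, hndvd, hσ⟩ := exists_prime_linear_factor hψ (by simpa using hn) hirr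
    have hM : ∀ x, coordForm (gram φ e) F x = 0 → x = 0 := fun x hx => by
      by_contra hx0
      exact hni ((isIsotropic_congr (coordIsometry φ e)).1 ⟨x, hx0, hx⟩)
    refine notMem_evenUnits hπ (a := MvPolynomial.C (a : F) * h)
      (hπ.not_dvd_mul (fun hdvd => hπ.not_isUnit (isUnit_of_dvd_unit hdvd hCa)) hndvd) ?_
      (repGroup_le_evenUnits (gram φ e) hπ (fun f hf i => ?_) hq)
    · rw [hqa, scaledGenericValue, formPoly_eq_coordForm, hπh]
      congr 1
      ring
    · rw [← hσ, ← coordForm_comp] at hf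
      exact (hσ _).1 (congrFun (anisotropic_mvPolynomial _ hM _ hf) i)

end FunctionFieldForms

end CharTwoQF

theorem mainTheorem1 {F : Type u} [Field F] [CharP F 2]
    {V : Type v₁} [AddCommGroup V] [Module F V] [FiniteDimensional F V]
    {W : Type v₂} [AddCommGroup W] [Module F W] [FiniteDimensional F W]
    (φ : QuadraticForm F V) (ψ : QuadraticForm F W)
    (hφ : IsNondefective φ) (hψ : IsNondefective ψ)
    (hdim : 2 ≤ Module.finrank F W)
    (b : Module.Basis (Fin (Module.finrank F W)) F W) :
    [ -- (i)
      IsotropicOverFunctionField φ ψ b,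
      -- (ii)
      ∀ (E : Type (max u w)) [Field E] [Algebra F E], IsAdmissible φ ψ E →
        repUnits (extend E ψ) ^ 2 ⊆ repUnits (extend E φ) ^ 2,
      -- (iii)
      ∀ a ∈ repUnits ψ, ∃ q ∈ repUnits (extend (RatField F (Module.finrank F W)) φ) ^ 2,
        (q : RatField F (Module.finrank F W)) = scaledGenericValue a ψ b,
      -- (iv)
      ∀ (E : Type (max u w)) [Field E] [Algebra F E], IsAdmissible φ ψ E →
        repSqGroup (extend E ψ) ≤
          repSqGroup (extend E φ),
      -- (v)
      ∀ a ∈ repUnits ψ,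
        ∃ q ∈ repSqGroup (extend (RatField F (Module.finrank F W)) φ),
          (q : RatField F (Module.finrank F W)) = scaledGenericValue a ψ b,
      -- (vi)
      ∀ (E : Type (max u w)) [Field E] [Algebra F E], IsAdmissible φ ψ E →
        ∀ a ∈ repUnits ψ,
          repGroup (extend E ((a : F) • ψ)) ≤
            repGroup (extend E φ),
      -- (vii)
      ∀ a ∈ repUnits ψ,
        ∃ q ∈ repGroup (extend (RatField F (Module.finrank F W)) φ),
          (q : RatField F (Module.finrank F W)) = scaledGenericValue a ψ b ].TFAE := by
  -- `F(X)`, lifted to the universe over which the extensions `E` range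
  let n := Module.finrank F W
  let K := RatField F n
  let up : K →ₐ[F] ULift.{w} K := (ULift.algEquiv (R := F)).symm.toAlgHom
  let down : ULift.{w} K →ₐ[F] K := (ULift.algEquiv (R := F)).toAlgHom
  have hdown : ∀ c : Kˣ,
      Units.map (down : ULift.{w} K →* K) (Units.map (up : K →* ULift.{w} K) c) = c := fun _ => rfl
  have hadm : IsAdmissible φ ψ (ULift.{w} K) := fun _ => isNondefective_extend_ratField hφ n
  tfae_have 1 → 2 := fun h E _ _ _ =>
    repUnits_sq_subset_of_isotropicOverFunctionField b hφ h E
  tfae_have 2 → 3 := by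
    intro h a ha
    obtain ⟨g, hg, hga⟩ := exists_generic_value b ψ ha
    refine ⟨_, ?_, hga⟩
    have h1 := h (ULift.{w} K) hadm (sq (repUnits (extend (ULift.{w} K) ψ)) ▸ Set.mul_mem_mul
      (map_mem_repUnits ψ up (mem_repUnits_extend K ha)) (map_mem_repUnits ψ up hg))
    rw [sq] at h1 ⊢
    obtain ⟨c₁, hc₁, c₂, hc₂, hc⟩ := h1
    refine ⟨_, map_mem_repUnits φ down hc₁, _, map_mem_repUnits φ down hc₂, ?_⟩
    simp only [← map_mul] at hc ⊢
    rw [hc, hdown]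
  tfae_have 2 → 4 := fun h E _ _ hE => Subgroup.closure_mono (h E hE)
  tfae_have 3 → 5 := fun h a ha => by
    obtain ⟨q, hq, hqa⟩ := h a ha
    exact ⟨q, Subgroup.subset_closure hq, hqa⟩
  tfae_have 5 → 7 := fun h a ha => by
    obtain ⟨q, hq, hqa⟩ := h a ha
    exact ⟨q, repSqGroup_le_repGroup _ hq, hqa⟩
  tfae_have 4 → 6 := fun h E _ _ hE a ha => by
    rw [repGroup, Subgroup.closure_le]
    intro c hc
    refine repSqGroup_le_repGroup _ (h E hE (Subgroup.subset_closure ?_))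
    rw [← mul_inv_cancel_left (Units.map (algebraMap F E : F →* E) a) c,
      mem_repUnits_extend_smul_iff] at hc
    rw [sq, ← mul_inv_cancel_left (Units.map (algebraMap F E : F →* E) a) c]
    exact Set.mul_mem_mul (mem_repUnits_extend E ha) hc
  tfae_have 6 → 7 := by
    intro h a ha
    obtain ⟨g, hg, hga⟩ := exists_generic_value b ψ ha
    refine ⟨_, ?_, hga⟩
    have h1 := h (ULift.{w} K) hadm a ha (Subgroup.subset_closure
      (map_mem_repUnits _ up ((mem_repUnits_extend_smul_iff K ψ a g).2 hg)))
    -- the group over the lifted field maps back into the group over `F(X)`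
    have h2 : (repGroup (extend (ULift.{w} K) φ)).map (Units.map (down : ULift.{w} K →* K)) ≤
        repGroup (extend K φ) := by
      rw [repGroup, MonoidHom.map_closure, Subgroup.closure_le]
      rintro _ ⟨c, hc, rfl⟩
      exact Subgroup.subset_closure (map_mem_repUnits φ down hc)
    exact h2 ⟨_, h1, hdown _⟩
  tfae_have 7 → 1 := by
    intro h
    obtain ⟨a, ha⟩ : ∃ a, a ∈ repUnits ψ := by
      by_contra! hall
      have hzero : ∀ x, ψ x = 0 := fun x => by
        by_contra hx
        exact hall (Units.mk0 _ hx) ⟨x, rfl⟩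
      have : Nontrivial W := Module.nontrivial_of_finrank_pos (R := F) (by omega)
      obtain ⟨x, hx⟩ := exists_ne (0 : W)
      refine hx ((Submodule.mem_bot F).1 (isNondefective_iff_radical.1 hψ ▸ ?_))
      rw [mem_radical_iff_polar]
      simp [QuadraticMap.polar, hzero]
    obtain ⟨q, hq, hqa⟩ := h a ha
    exact isotropicOverFunctionField_of_mem_repGroup b (by omega) hψ hq hqa
  tfae_finish
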